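/- For a nonempty open interval $I=(a,b)\subseteq\mathbb{R}$, $-\infty\le a<b\le+\infty$, let $\mathrm{Lip}(I)$ be the vector space of all Lipschitz functions $f:I\to\mathbb{R}$ with the seminorm $\|f\|_{\mathrm{Lip}}=\sup_{x\ne y}\frac{|f(x)-f(y)|}{|x-y|}$. The Clarke subdifferential of $f$ at $x\in I$ is the convex hull $\partial f(x)$ of the set of all limits $\lim_n f'(x_n)$, where $x_n\to x$ and $f$ is differentiable at every $x_n\in I$. A function $f\in\mathrm{Lip}(I)$ is Clarke exhaustive if for every nonempty closed convex set $K\subseteq[-\|f\|_{\mathrm{Lip}},\|f\|_{\mathrm{Lip}}]$ there is $x\in I$ with $\partial f(x)=K$. Let $\mathcal{E}\subseteq\mathrm{Lip}(I)$ be the set of all everywhere differentiable, Clarke exhaustive Lipschitz functions on $I$. Then the following hold. 1. $\mathcal{E}$ is spaceable in $(\mathrm{Lip}(I),\|\cdot\|_{\mathrm{Lip}})$: it contains an infinite-dimensional linear subspace of $\mathrm{Lip}(I)$ that is closed for the seminorm $\|\cdot\|_{\mathrm{Lip}}$. 2. There are real numbers $a<a_n<b_n<a_{n+1}<b$ $(n\in\mathbb{N})$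 and functions $f_n\in\mathcal{E}$ with $\|f_n\|_{\mathrm{Lip}}=1$ and $\operatorname{supp} f_n\subset(a_n,b_n)$ for all $n$. 3. For every choice of $(a_n)$, $(b_n)$, $(f_n)$ as in 2, the formula $T(x)(t)=\sum_{n} x_n f_n(t)$ $(t\in I)$ defines a linear isometry $T$ from $c_0(\mathbb{N})$ (with the supremum norm) into $(\mathrm{Lip}(I),\|\cdot\|_{\mathrm{Lip}})$, and $T(x)\in\mathcal{E}$ for every $x\in c_0(\mathbb{N})$. In particular $\mathcal{E}$ contains an isometric copy of $c_0(\mathbb{N})$. -/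

import Mathlib

open scoped NNReal ZeroAtInfty Topology

/-- The quantity `‖f‖_Lip = sup_{x ≠ y} |f x - f y| / |x - y|` of a function `f : U → ℝ`
(the diagonal pairs contribute the value `0 / 0 = 0`, which does not change the supremum).
It is only used for Lipschitz `f`, where the supremum is over a bounded family. -/
noncomputable def lipSup {U : Set ℝ} (f : U → ℝ) : ℝ :=
  ⨆ p : U × U, |f p.1 - f p.2| / |(p.1 : ℝ) - (p.2 : ℝ)|

/-- The vector subspace of the Lipschitz functions in `U → ℝ`. -/
def lipSubmodule (U : Set ℝ) : Submodule ℝ (U → ℝ) where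
  carrier := {f | ∃ k : ℝ≥0, LipschitzWith k f}
  zero_mem' := ⟨0, LipschitzWith.const 0⟩
  add_mem' := by
    rintro f g ⟨k, hk⟩ ⟨l, hl⟩
    exact ⟨k + l, hk.add hl⟩
  smul_mem' := by
    rintro c f ⟨k, hk⟩
    refine ⟨‖c‖₊ * k, ?_⟩
    exact (lipschitzWith_smul c).comp hk

/-- `Lip(U)`: the vector space of all real-valued Lipschitz functions on `U`. A type of its own,
so that it carries the topology of `‖·‖_Lip` and not that of pointwise convergence. -/
def LipSpace (U : Set ℝ) : Type := lipSubmodule U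

namespace LipSpace

variable {U : Set ℝ}

instance : AddCommGroup (LipSpace U) := inferInstanceAs (AddCommGroup (lipSubmodule U))

instance : Module ℝ (LipSpace U) := inferInstanceAs (Module ℝ (lipSubmodule U))

/-- The underlying function of an element of `Lip(U)`. -/
def toFun (f : LipSpace U) : U → ℝ := Subtype.val (p := fun g => g ∈ lipSubmodule U) f

instance : CoeFun (LipSpace U) (fun _ => U → ℝ) := ⟨toFun⟩

theorem add_apply (f g : LipSpace U) (x : U) : (f + g) x = f x + g x := rfl

theorem smul_apply (c : ℝ) (f : LipSpace U) (x : U) : (c • f) x = c * f x := rfl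

theorem zero_apply (x : U) : (0 : LipSpace U) x = 0 := rfl

theorem exists_lipschitz (f : LipSpace U) : ∃ k : ℝ≥0, LipschitzWith k f.toFun :=
  Subtype.property (p := fun g => g ∈ lipSubmodule U) f

theorem bddAbove_quotients (f : LipSpace U) :
    BddAbove (Set.range fun p : U × U => |f p.1 - f p.2| / |(p.1 : ℝ) - (p.2 : ℝ)|) := by
  obtain ⟨k, hk⟩ := f.exists_lipschitz
  refine ⟨k, ?_⟩
  rintro _ ⟨p, rfl⟩
  refine div_le_of_le_mul₀ (abs_nonneg _) k.2 ?_
  simpa [Real.dist_eq, Subtype.dist_eq] using hk.dist_le_mul p.1 p.2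

/-- `‖·‖_Lip` as a seminorm on `Lip(U)`. -/
noncomputable def lipSeminorm (U : Set ℝ) : Seminorm ℝ (LipSpace U) :=
  Seminorm.of (fun f => lipSup f.toFun)
    (by
      intro f g
      refine Real.iSup_le (fun p => ?_)
        (add_nonneg (Real.iSup_nonneg fun _ => by positivity)
          (Real.iSup_nonneg fun _ => by positivity))
      refine le_trans ?_ (add_le_add (le_ciSup f.bddAbove_quotients p)
        (le_ciSup g.bddAbove_quotients p))
      rw [← add_div, add_apply, add_apply]
      gcongr
      rw [add_sub_add_comm]
      exact abs_add_le _ _)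
    (by
      intro c f
      simp only [lipSup]
      rw [Real.norm_eq_abs, Real.mul_iSup_of_nonneg (abs_nonneg c)]
      congr 1
      ext p
      rw [smul_apply, smul_apply, ← mul_sub, abs_mul, mul_div_assoc])

noncomputable instance : SeminormedAddCommGroup (LipSpace U) :=
  (lipSeminorm U).toAddGroupSeminorm.toSeminormedAddCommGroup

theorem norm_def (f : LipSpace U) : ‖f‖ = lipSup f.toFun := rfl

noncomputable instance : NormedSpace ℝ (LipSpace U) where
  norm_smul_le c f := le_of_eq (map_smul_eq_mul (lipSeminorm U) c f)

end LipSpace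

/-- `f : U → ℝ` has derivative `d` at the point `x` of `U`. Only the values of `f` on `U` matter,
not those of the extension of `f` by `0`; for open `U` this is the usual derivative. -/
def HasDerivOnAt {U : Set ℝ} (f : U → ℝ) (d : ℝ) (x : U) : Prop :=
  HasDerivWithinAt (Function.extend Subtype.val f 0) d U x

/-- The Clarke subdifferential of `f : U → ℝ` at `x`: the convex envelope of all limits of
derivatives of `f` along sequences of differentiability points that converge to `x`. (Leaving out
a null set of points as well would give the same set for Lipschitz `f`.) -/
def clarkeSubdiff {U : Set ℝ} (f : U → ℝ) (x : U) : Set ℝ :=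
  convexHull ℝ {p : ℝ | ∃ (u : ℕ → U) (d : ℕ → ℝ), (∀ n, HasDerivOnAt f (d n) (u n)) ∧
    Filter.Tendsto u Filter.atTop (𝓝 x) ∧ Filter.Tendsto d Filter.atTop (𝓝 p)}

/-- A Lipschitz function is Clarke exhaustive if every nonempty closed convex subset of the closed
ball of centre `0` and radius `‖f‖_Lip` is its Clarke subdifferential at some point. -/
def ClarkeExhaustive {U : Set ℝ} (f : LipSpace U) : Prop :=
  ∀ K : Set ℝ, K.Nonempty → IsClosed K → Convex ℝ K → K ⊆ Metric.closedBall 0 ‖f‖ →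
    ∃ x : U, clarkeSubdiff f x = K

/-- The everywhere differentiable, Clarke exhaustive Lipschitz functions on `U`. -/
def exhaustiveSet (U : Set ℝ) : Set (LipSpace U) :=
  {f | (∀ x : U, ∃ d : ℝ, HasDerivOnAt f d x) ∧ ClarkeExhaustive f}

/-- The open interval `(a, b)` of real numbers, with possibly infinite end points. -/
def openInterval (a b : EReal) : Set ℝ := {t : ℝ | a < (t : EReal) ∧ (t : EReal) < b}

/-- A subset of a seminormed space is spaceable if it contains a closed infinite-dimensional
linear subspace. -/
def IsSpaceable {X : Type*} [SeminormedAddCommGroup X] [NormedSpace ℝ X] (E : Set X) : Prop :=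
  ∃ W : Submodule ℝ X, IsClosed (W : Set X) ∧ ¬ FiniteDimensional ℝ W ∧ (W : Set X) ⊆ E

/-- The data of the construction on `(a, b)`: intervals `(α n, β n)` with
`a < α n < β n < α (n + 1) < b`, and everywhere differentiable, Clarke exhaustive functions `f n`
with `‖f n‖_Lip = 1` whose (closed) supports lie in `(α n, β n)`. -/
structure IsDisjointExhaustiveSeq (a b : EReal) (α β : ℕ → ℝ)
    (f : ℕ → LipSpace (openInterval a b)) : Prop where
  left_lt : ∀ n, a < (α n : EReal)
  lt : ∀ n, α n < β n
  lt_succ : ∀ n, β n < α (n + 1)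
  lt_right : ∀ n, (β n : EReal) < b
  mem : ∀ n, f n ∈ exhaustiveSet (openInterval a b)
  norm_eq : ∀ n, ‖f n‖ = 1
  supp : ∀ n, tsupport (f n).toFun ⊆ {t | (t : ℝ) ∈ Set.Ioo (α n) (β n)}

/-! For an everywhere differentiable function, the Clarke subdifferential is the convex hull of the
cluster values of the derivative. A bounded derivative is therefore needed whose cluster hulls run
through all `[c, d] ⊆ [-1, 1]`. The Cantor space maps continuously onto the square `[-1, 1]²`.
Placing it in the line as a nowhere dense compact set and extending the two coordinates gives
continuous `C`, `D` such that `(C, D)` takes every value `(c, d)` on that set. If `w` is a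
derivative bounded by `1` that oscillates between `-1` and `1` near every point of the set
(`exists_derivative_oscillating`), then `(C + D) / 2 + (D - C) / 2 * w` is again a derivative
(`hasDerivAt_integral_continuous_mul`), and it clusters exactly between `c` and `d` where `(C, D) =
(c, d)`. A cut-off and a translated negative copy make the primitive compactly supported. For
disjointly supported `f n` and `x` in `c₀`, the derivative of `∑ x n * f n` is `x n * (f n)'` on the
`n`th interval; at a limit of the intervals it is `0` because `x n → 0`. Hence the seminorm is `max
|x n|`. It is attained at some `N`, and `x N * f N` alone supplies every required `K`, except that
`{0}` may have to be found between the supports. For spaceability, the range of the isometry is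
enlarged to its closure, which only adds constants. -/

/-! ### Derivatives oscillating along a nowhere dense closed set -/

/-- A primitive of `s ↦ cos (1 / s)` (with value `0` at `0`). -/
theorem exists_hasDerivAt_cos_inv : ∃ ψ : ℝ → ℝ, ψ 0 = 0 ∧ HasDerivAt ψ 0 0 ∧
    ∀ s, s ≠ 0 → HasDerivAt ψ (Real.cos s⁻¹) s := by
  have hc : Continuous fun s : ℝ => 2 * s * Real.sin s⁻¹ := by
    rw [continuous_iff_continuousAt]
    intro s
    by_cases hs : s = 0
    · subst hs
      have h0 : Filter.Tendsto (fun s : ℝ => 2 * |s|) (𝓝 0) (𝓝 0) := by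
        have : Continuous fun s : ℝ => 2 * |s| := by fun_prop
        simpa using this.tendsto 0
      have := squeeze_zero_norm (f := fun s : ℝ => 2 * s * Real.sin s⁻¹) (fun s => by
        rw [norm_mul, norm_mul, Real.norm_eq_abs, Real.norm_eq_abs, Real.norm_eq_abs]
        have := Real.abs_sin_le_one s⁻¹
        have h2 : |(2 : ℝ)| = 2 := by norm_num
        rw [h2]
        exact mul_le_of_le_one_right (by positivity) this) h0
      simpa [ContinuousAt] using this
    · fun_prop (disch := assumption)
  have hQ : ∀ s, HasDerivAt (fun s => ∫ r in (0 : ℝ)..s, 2 * r * Real.sin r⁻¹)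
      (2 * s * Real.sin s⁻¹) s := fun s => hc.integral_hasStrictDerivAt 0 s |>.hasDerivAt
  have hsq : HasDerivAt (fun s : ℝ => s ^ 2 * Real.sin s⁻¹) 0 0 := by
    rw [hasDerivAt_iff_isLittleO]
    have h1 : (fun s : ℝ => s ^ 2 * Real.sin s⁻¹) =O[𝓝 0] fun s => s ^ 2 := by
      refine Asymptotics.IsBigO.of_bound 1 (Filter.Eventually.of_forall fun s => ?_)
      rw [norm_mul, mul_comm]
      exact mul_le_mul_of_nonneg_right (Real.abs_sin_le_one _) (norm_nonneg _)
    have h2 : (fun s : ℝ => s ^ 2) =o[𝓝 0] fun s => s := by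
      simpa using Asymptotics.isLittleO_pow_id (𝕜 := ℝ) (n := 2) (by norm_num)
    simpa using h1.trans_isLittleO h2
  -- The derivative of `s ^ 2 * sin s⁻¹` is `2 * s * sin s⁻¹ - cos s⁻¹`, whose first term is
  -- continuous; removing it by integration leaves the cosine.
  refine ⟨fun s => (∫ r in (0 : ℝ)..s, 2 * r * Real.sin r⁻¹) - s ^ 2 * Real.sin s⁻¹, by simp,
    by simpa using (hQ 0).fun_sub hsq, fun s hs => ?_⟩
  have h3 : HasDerivAt (fun s : ℝ => s ^ 2 * Real.sin s⁻¹)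
      (2 * s * Real.sin s⁻¹ - Real.cos s⁻¹) s := by
    have := ((hasDerivAt_id' s).fun_pow 2).fun_mul
      ((Real.hasDerivAt_sin s⁻¹).comp s (hasDerivAt_inv hs))
    refine this.congr_deriv ?_
    simp only [Function.comp_apply]
    field_simp
    ring
  exact ((hQ s).fun_sub h3).congr_deriv (by ring)

/-- For `t` in a complementary interval `(u, v)` of `S`, the number `(t - u) (v - t) / (v - u)`;
for `t` in `S`, zero. -/
noncomputable def gapProfile (S : Set ℝ) (t : ℝ) : ℝ :=
  (t - sSup (S ∩ Set.Iic t)) * (sInf (S ∩ Set.Ici t) - t) /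
    (sInf (S ∩ Set.Ici t) - sSup (S ∩ Set.Iic t))

theorem gapProfile_of_mem {S : Set ℝ} {t : ℝ} (ht : t ∈ S) : gapProfile S t = 0 := by
  have h : IsGreatest (S ∩ Set.Iic t) t := ⟨⟨ht, Set.self_mem_Iic⟩, fun _ h => h.2⟩
  simp [gapProfile, h.csSup_eq]

theorem gapProfile_of_gap {S : Set ℝ} {u v t : ℝ} (hu : u ∈ S) (hv : v ∈ S)
    (huv : ∀ s ∈ Set.Ioo u v, s ∉ S) (ht : t ∈ Set.Ioo u v) :
    gapProfile S t = (t - u) * (v - t) / (v - u) := by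
  have h1 : IsGreatest (S ∩ Set.Iic t) u := ⟨⟨hu, ht.1.le⟩, fun s h => by
    by_contra! hs
    exact huv s ⟨hs, lt_of_le_of_lt h.2 ht.2⟩ h.1⟩
  have h2 : IsLeast (S ∩ Set.Ici t) v := ⟨⟨hv, ht.2.le⟩, fun s h => by
    by_contra! hs
    exact huv s ⟨lt_of_lt_of_le ht.1 h.2, hs⟩ h.1⟩
  rw [gapProfile, h1.csSup_eq, h2.csInf_eq]

theorem IsClosed.exists_gap {S : Set ℝ} (hS : IsClosed S) (hl : ∀ t, ∃ u ∈ S, u ≤ t)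
    (hr : ∀ t, ∃ v ∈ S, t ≤ v) {t : ℝ} (ht : t ∉ S) :
    ∃ u ∈ S, ∃ v ∈ S, t ∈ Set.Ioo u v ∧ ∀ s ∈ Set.Ioo u v, s ∉ S := by
  have hb1 : BddAbove (S ∩ Set.Iic t) := ⟨t, fun s h => h.2⟩
  have hb2 : BddBelow (S ∩ Set.Ici t) := ⟨t, fun s h => h.2⟩
  have h1 := (hS.inter isClosed_Iic).csSup_mem (s := S ∩ Set.Iic t)
    (let ⟨u, hu, h⟩ := hl t; ⟨u, hu, h⟩) hb1
  have h2 := (hS.inter isClosed_Ici).csInf_mem (s := S ∩ Set.Ici t)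
    (let ⟨u, hu, h⟩ := hr t; ⟨u, hu, h⟩) hb2
  refine ⟨_, h1.1, _, h2.1, ⟨lt_of_le_of_ne h1.2 fun h => ht (h ▸ h1.1),
    lt_of_le_of_ne h2.2 fun h => ht (h ▸ h2.1)⟩, fun s hs hsS => ?_⟩
  rcases le_total s t with h | h
  · exact absurd (le_csSup hb1 ⟨hsS, h⟩) (not_le.2 hs.1)
  · exact absurd (csInf_le hb2 ⟨hsS, h⟩) (not_le.2 hs.2)

theorem gap_formula_bounds {u v t : ℝ} (ht : t ∈ Set.Ioo u v) :
    0 < (t - u) * (v - t) / (v - u) ∧ (t - u) * (v - t) / (v - u) ≤ t - u ∧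
      (t - u) * (v - t) / (v - u) ≤ v - t := by
  obtain ⟨h1, h2⟩ := ht
  have h3 : 0 < v - u := by linarith
  have h4 : 0 < t - u := by linarith
  have h5 : 0 < v - t := by linarith
  refine ⟨by positivity, ?_, ?_⟩ <;> rw [div_le_iff₀ h3] <;> nlinarith

/-- On the real line, every unbounded nowhere dense closed set `S` admits a derivative bounded by
`1` that clusters at `1` and at `-1` at every point of `S`. -/
theorem exists_derivative_oscillating {S : Set ℝ} (hS : IsClosed S) (hl : ∀ t, ∃ u ∈ S, u ≤ t)
    (hr : ∀ t, ∃ v ∈ S, t ≤ v) (hi : interior S = ∅) :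
    ∃ W w : ℝ → ℝ, (∀ t, HasDerivAt W (w t) t) ∧ (∀ t, |w t| ≤ 1) ∧
      ∀ x ∈ S, ∀ σ : ℝ, (σ = 1 ∨ σ = -1) → ∀ ε > 0, ∃ t, |t - x| < ε ∧ |w t - σ| < ε := by
  obtain ⟨ψ, ψ0, hψ0, hψ⟩ := exists_hasDerivAt_cos_inv
  -- The profile is at most the distance to `S`. As `ψ` has derivative `0` at `0`, this makes `ψ ∘
  -- gapProfile S` differentiable with derivative `0` on `S`.
  have hbound : ∀ x ∈ S, ∀ t, |gapProfile S t| ≤ |t - x| := by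
    intro x hx t
    by_cases ht : t ∈ S
    · simp [gapProfile_of_mem ht]
    obtain ⟨u, hu, v, hv, htuv, huv⟩ := hS.exists_gap hl hr ht
    obtain ⟨h0, h1, h2⟩ := gap_formula_bounds htuv
    rw [gapProfile_of_gap hu hv huv htuv, abs_of_pos h0]
    by_cases hxu : x ≤ u
    · exact h1.trans ((by linarith : t - u ≤ t - x).trans (le_abs_self _))
    · have : v ≤ x := by
        by_contra! h
        exact huv x ⟨not_le.1 hxu, h⟩ hx
      rw [abs_sub_comm]
      exact h2.trans ((by linarith : v - t ≤ x - t).trans (le_abs_self _))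
  have hgap : ∀ u ∈ S, ∀ v ∈ S, (∀ s ∈ Set.Ioo u v, s ∉ S) → ∀ t ∈ Set.Ioo u v,
      HasDerivAt (ψ ∘ gapProfile S)
        (Real.cos ((t - u) * (v - t) / (v - u))⁻¹ * ((u + v - 2 * t) / (v - u))) t := by
    intro u hu v hv huv t ht
    have hev : gapProfile S =ᶠ[𝓝 t] fun t => (t - u) * (v - t) / (v - u) :=
      (Filter.eventually_of_mem (Ioo_mem_nhds ht.1 ht.2)
        fun s hs => gapProfile_of_gap hu hv huv hs)
    have hP : HasDerivAt (fun t => (t - u) * (v - t) / (v - u)) ((u + v - 2 * t) / (v - u)) t := by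
      have := (((hasDerivAt_id' t).sub_const u).fun_mul ((hasDerivAt_id' t).const_sub v)).div_const
        (v - u)
      exact this.congr_deriv (by ring)
    have := (hψ _ (gap_formula_bounds ht).1.ne').comp t hP
    exact this.congr_of_eventuallyEq (hev.fun_comp ψ)
  have hmem : ∀ x ∈ S, HasDerivAt (ψ ∘ gapProfile S) 0 x := by
    intro x hx
    have hP0 := gapProfile_of_mem hx
    rw [hasDerivAt_iff_isLittleO] at hψ0 ⊢
    have hO : gapProfile S =O[𝓝 x] fun t => t - x :=
      Asymptotics.IsBigO.of_bound 1 (Filter.Eventually.of_forall fun t => by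
        simpa using hbound x hx t)
    have ht : Filter.Tendsto (gapProfile S) (𝓝 x) (𝓝 0) := by
      refine hO.trans_tendsto ?_
      have : Continuous fun t => t - x := by fun_prop
      simpa using this.tendsto x
    have := (hψ0.comp_tendsto ht).trans_isBigO (k := fun t => t - x) (by
      simpa [Function.comp_def] using hO)
    simpa [Function.comp_def, hP0, ψ0] using this
  have hslope : ∀ u v t : ℝ, t ∈ Set.Ioo u v → |(u + v - 2 * t) / (v - u)| ≤ 1 := by
    intro u v t ht
    have h : 0 < v - u := by linarith [ht.1, ht.2]
    rw [abs_div, abs_of_pos h, div_le_one h, abs_le]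
    constructor <;> linarith [ht.1, ht.2]
  refine ⟨ψ ∘ gapProfile S, deriv (ψ ∘ gapProfile S), fun t => ?_, fun t => ?_, ?_⟩
  · by_cases ht : t ∈ S
    · exact (hmem t ht).differentiableAt.hasDerivAt
    · obtain ⟨u, hu, v, hv, htuv, huv⟩ := hS.exists_gap hl hr ht
      exact (hgap u hu v hv huv t htuv).differentiableAt.hasDerivAt
  · by_cases ht : t ∈ S
    · simp [(hmem t ht).deriv]
    · obtain ⟨u, hu, v, hv, htuv, huv⟩ := hS.exists_gap hl hr ht
      rw [(hgap u hu v hv huv t htuv).deriv, abs_mul]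
      exact mul_le_one₀ (Real.abs_cos_le_one _) (abs_nonneg _) (hslope u v t htuv)
  · intro x hx σ hσ ε hε
    -- A gap `(u, v)` meets every right neighbourhood of `x`, and `x ≤ u`. Just to the right of `u`
    -- the profile is small and its slope `1 - 2 * (s - u) / (v - u)` is almost `1`, so the
    -- derivative of the composite follows the cosine through `±1`.
    obtain ⟨t₀, ht₀, ht₀S⟩ : ∃ t ∈ Set.Ioo x (x + ε / 2), t ∉ S := by
      by_contra! h
      have h1 : Set.Ioo x (x + ε / 2) ⊆ interior S := interior_maximal h isOpen_Ioo
      rw [hi] at h1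
      exact h1 (show x + ε / 4 ∈ Set.Ioo x (x + ε / 2) by constructor <;> linarith)
    obtain ⟨u, hu, v, hv, htuv, huv⟩ := hS.exists_gap hl hr ht₀S
    have hxu : x ≤ u := by
      by_contra! h
      exact huv x ⟨h, ht₀.1.trans htuv.2⟩ hx
    have huv' : 0 < v - u := by linarith [htuv.1, htuv.2]
    obtain ⟨s₀, hs₀u, hs₀⟩ : ∃ s₀, u < s₀ ∧ s₀ < t₀ ∧ 2 * (s₀ - u) / (v - u) < ε := by
      have hm : 0 < min (t₀ - u) (ε * (v - u) / 2) :=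
        lt_min (by linarith [htuv.1]) (by positivity)
      refine ⟨u + min (t₀ - u) (ε * (v - u) / 2) / 2, by linarith, ?_, ?_⟩
      · linarith [min_le_left (t₀ - u) (ε * (v - u) / 2)]
      · rw [div_lt_iff₀ huv']
        linarith [min_le_right (t₀ - u) (ε * (v - u) / 2)]
    have hs₀v : s₀ ∈ Set.Ioo u v := ⟨hs₀u, hs₀.1.trans htuv.2⟩
    have hP₀ := (gap_formula_bounds hs₀v).1
    -- Any `y` above the reciprocal of the profile at `s₀` is the reciprocal of the profile at some
    -- `s` in `(u, s₀)`.
    obtain ⟨y, hy, hyσ⟩ : ∃ y, ((s₀ - u) * (v - s₀) / (v - u))⁻¹ < y ∧ Real.cos y = σ := by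
      obtain ⟨n, hn⟩ := exists_nat_gt (((s₀ - u) * (v - s₀) / (v - u))⁻¹)
      have hpi := Real.pi_gt_three
      have hn0 : (0 : ℝ) ≤ n := n.cast_nonneg
      rcases hσ with rfl | rfl
      · exact ⟨n * (2 * Real.pi), by nlinarith, Real.cos_nat_mul_two_pi n⟩
      · exact ⟨n * (2 * Real.pi) + Real.pi, by nlinarith, Real.cos_nat_mul_two_pi_add_pi n⟩
    have hy0 : 0 < y := (inv_pos.2 hP₀).trans hy
    obtain ⟨s, hs, hsy⟩ : y⁻¹ ∈ (fun s => (s - u) * (v - s) / (v - u)) '' Set.Ioo u s₀ := by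
      refine intermediate_value_Ioo hs₀u.le (by fun_prop) ⟨by simpa using hy0, ?_⟩
      rw [inv_lt_comm₀ hy0 hP₀]
      exact hy
    have hsv : s ∈ Set.Ioo u v := ⟨hs.1, hs.2.trans hs₀v.2⟩
    refine ⟨s, ?_, ?_⟩
    · rw [abs_of_nonneg (by linarith [hs.1])]
      linarith [hs.2, hs₀.1, ht₀.2]
    · rw [(hgap u hu v hv huv s hsv).deriv,
        show (s - u) * (v - s) / (v - u) = y⁻¹ from hsy, inv_inv, hyσ]
      have h1 : σ * ((u + v - 2 * s) / (v - u)) - σ = -σ * (2 * (s - u) / (v - u)) := by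
        field_simp
        ring
      have h2 : |-σ| = 1 := by rcases hσ with rfl | rfl <;> simp
      have h3 : 0 ≤ 2 * (s - u) / (v - u) := by
        have : 0 < s - u := by linarith [hs.1]
        positivity
      rw [h1, abs_mul, h2, one_mul, abs_of_nonneg h3]
      refine lt_of_le_of_lt ?_ hs₀.2
      have := hs.2.le
      gcongr

/-- The product of a bounded derivative with a continuous function is a derivative. -/
theorem hasDerivAt_integral_continuous_mul {W w g : ℝ → ℝ} {M : ℝ}
    (hW : ∀ t, HasDerivAt W (w t) t) (hw : ∀ t, |w t| ≤ M) (hg : Continuous g) (a x : ℝ) :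
    HasDerivAt (fun t => ∫ s in a..t, g s * w s) (g x * w x) x := by
  have hM : 0 ≤ M := (abs_nonneg _).trans (hw 0)
  have hwm : Measurable w := by
    have : w = deriv W := funext fun t => (hW t).deriv.symm
    rw [this]
    exact measurable_deriv W
  have hwi : ∀ r t, IntervalIntegrable w MeasureTheory.volume r t := fun r t =>
    (intervalIntegrable_const (c := M)).mono_fun hwm.aestronglyMeasurable
      (Filter.Eventually.of_forall fun t => (hw t).trans (le_abs_self M))
  have hgwi : ∀ r t, IntervalIntegrable (fun s => g s * w s) MeasureTheory.volume r t :=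
    fun r t => (hwi r t).continuousOn_mul hg.continuousOn
  -- Freezing `g` at `x` leaves an error with integrand `(g s - g x) * w s`, which is `o(t - x)` by
  -- continuity of `g` and boundedness of `w`.
  have key : ∀ t, (∫ s in a..t, g s * w s) - (∫ s in a..x, g s * w s) - g x * (W t - W x)
      = ∫ s in x..t, (g s - g x) * w s := by
    intro t
    rw [intervalIntegral.integral_interval_sub_left (hgwi _ _) (hgwi _ _),
      ← intervalIntegral.integral_eq_sub_of_hasDerivAt (fun s _ => hW s) (hwi x t),
      ← intervalIntegral.integral_const_mul,
      ← intervalIntegral.integral_sub (hgwi _ _) ((hwi _ _).const_mul _)]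
    simp only [sub_mul]
  have hW' := (hW x).const_mul (g x)
  rw [hasDerivAt_iff_isLittleO] at hW' ⊢
  have h2 : (fun t => ∫ s in x..t, (g s - g x) * w s) =o[𝓝 x] fun t => t - x := by
    rw [Asymptotics.isLittleO_iff]
    intro ε hε
    obtain ⟨δ, hδ, hgδ⟩ := Metric.continuousAt_iff.1 hg.continuousAt (ε / (M + 1)) (by positivity)
    filter_upwards [Metric.ball_mem_nhds x hδ] with t ht
    rw [Real.norm_eq_abs (t - x)]
    refine intervalIntegral.norm_integral_le_of_norm_le_const fun s hs => ?_
    have hs' : dist s x < δ := by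
      refine lt_of_le_of_lt ?_ (Metric.mem_ball.1 ht)
      rw [Real.dist_eq, Real.dist_eq]
      exact Set.abs_sub_left_of_mem_uIcc (Set.uIoc_subset_uIcc hs)
    have h3 := (hgδ hs').le
    rw [Real.dist_eq] at h3
    rw [norm_mul, Real.norm_eq_abs, Real.norm_eq_abs]
    calc |g s - g x| * |w s| ≤ ε / (M + 1) * (M + 1) := by
          gcongr
          exact (hw s).trans (by linarith)
      _ = ε := by field_simp
  refine (h2.add hW').congr_left fun t => ?_
  rw [← key t]
  simp only [smul_eq_mul]
  ring

/-! ### A derivative with all prescribed cluster intervals -/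

/-- A totally disconnected compact copy of the Cantor space in a given interval. -/
theorem exists_cantor_embedding {p q : ℝ} (hpq : p < q) : ∃ e : (ℕ → Bool) → ℝ,
    Topology.IsClosedEmbedding e ∧ (∀ z, e z ∈ Set.Icc p q) ∧ interior (Set.range e) = ∅ := by
  obtain ⟨e, hr, hc, hinj⟩ := (isClosed_Icc (a := p) (b := q)).exists_nat_bool_injection_of_not_countable
    (fun h => by
      have := h.measure_zero MeasureTheory.volume
      rw [Real.volume_Icc, ENNReal.ofReal_eq_zero] at this
      linarith)
  have he := hc.isClosedEmbedding hinj
  refine ⟨e, he, fun z => hr ⟨z, rfl⟩, ?_⟩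
  have htd : IsTotallyDisconnected (Set.range e) :=
    he.isEmbedding.isTotallyDisconnected_range.2 inferInstance
  by_contra hne
  obtain ⟨x, hx⟩ := Set.nonempty_iff_ne_empty.2 hne
  obtain ⟨ε, hε, hb⟩ := Metric.isOpen_iff.1 isOpen_interior x hx
  have h1 := htd (Metric.ball x ε) (hb.trans interior_subset)
    (convex_ball x ε).isPreconnected
  have h2 := h1 (Metric.mem_ball_self hε) (show x + ε / 2 ∈ Metric.ball x ε by
    rw [Metric.mem_ball, Real.dist_eq, add_sub_cancel_left, abs_of_pos (by linarith)]
    linarith)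
  linarith

/-- A bounded derivative, vanishing outside of `(p, q)`, whose cluster sets are all the compact
subintervals of `[-1, 1]`. -/
theorem exists_exhaustive_derivative {p q : ℝ} (hpq : p < q) : ∃ F f : ℝ → ℝ,
    (∀ t, HasDerivAt F (f t) t) ∧ (∀ t, |f t| ≤ 1) ∧ (∀ t, t ∉ Set.Ioo p q → f t = 0) ∧
    ∀ c d, -1 ≤ c → c ≤ d → d ≤ 1 → ∃ x ∈ Set.Ioo p q,
      (∀ ε > 0, ∀ᶠ t in 𝓝 x, f t ∈ Set.Icc (c - ε) (d + ε)) ∧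
      ∀ y, y = c ∨ y = d → ∀ ε > 0, ∃ t, |t - x| < ε ∧ |f t - y| < ε := by
  obtain ⟨e, he, heI, hei⟩ := exists_cantor_embedding
    (show p + (q - p) / 3 < p + 2 * (q - p) / 3 by linarith)
  have hne : (Set.Icc (-1 : ℝ) 1).Nonempty := ⟨0, by norm_num, by norm_num⟩
  have := hne.to_subtype
  -- The square parametrises the pairs of end points. Pairs in the wrong order also occur, but do no
  -- harm.
  obtain ⟨φ, hφc, hφs⟩ := exists_nat_bool_continuous_surjective_of_compact
    (Set.Icc (-1 : ℝ) 1 × Set.Icc (-1 : ℝ) 1)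
  obtain ⟨C, hC, hCe⟩ := ContinuousMap.exists_extension_forall_mem_of_isClosedEmbedding
    (⟨fun z => ((φ z).1 : ℝ), by fun_prop⟩ : C(ℕ → Bool, ℝ)) (fun z => (φ z).1.2) hne he
  obtain ⟨D, hD, hDe⟩ := ContinuousMap.exists_extension_forall_mem_of_isClosedEmbedding
    (⟨fun z => ((φ z).2 : ℝ), by fun_prop⟩ : C(ℕ → Bool, ℝ)) (fun z => (φ z).2.2) hne he
  have hCe' : ∀ z, C (e z) = (φ z).1 := fun z => congrFun hCe z
  have hDe' : ∀ z, D (e z) = (φ z).2 := fun z => congrFun hDe z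
  obtain ⟨χ, hχ0, hχ1, hχ⟩ := exists_continuous_zero_one_of_isClosed
    (isOpen_Ioo (a := p) (b := q)).isClosed_compl he.isClosed_range (by
      rw [Set.disjoint_left]
      rintro _ h ⟨z, rfl⟩
      exact h ⟨by linarith [(heI z).1], by linarith [(heI z).2]⟩)
  have hZ : interior (Set.range ((↑) : ℤ → ℝ)) = ∅ :=
    interior_eq_empty_iff_dense_compl.2 ((Set.countable_range _).dense_compl ℝ)
  -- The integers are adjoined to the Cantor set only to make `S` unbounded on both sides.
  obtain ⟨W, w, hW, hw, hwS⟩ := exists_derivative_oscillating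
    (S := Set.range ((↑) : ℤ → ℝ) ∪ Set.range e)
    (Int.isClosedEmbedding_coe_real.isClosed_range.union he.isClosed_range)
    (fun t => ⟨⌊t⌋, Or.inl ⟨_, rfl⟩, Int.floor_le t⟩)
    (fun t => ⟨⌈t⌉, Or.inl ⟨_, rfl⟩, Int.le_ceil t⟩)
    (by rw [interior_union_isClosed_of_interior_empty
      Int.isClosedEmbedding_coe_real.isClosed_range hei, hZ])
  have hA : Continuous fun t => χ t * ((C t + D t) / 2) := by fun_prop
  have hB : Continuous fun t => χ t * ((D t - C t) / 2) := by fun_prop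
  refine ⟨fun t => (∫ s in (0 : ℝ)..t, χ s * ((C s + D s) / 2)) +
    ∫ s in (0 : ℝ)..t, χ s * ((D s - C s) / 2) * w s,
    fun t => χ t * ((C t + D t) / 2) + χ t * ((D t - C t) / 2) * w t,
    fun t => (hA.integral_hasStrictDerivAt 0 t).hasDerivAt.add
      (hasDerivAt_integral_continuous_mul hW hw hB 0 t), fun t => ?_, fun t ht => ?_, ?_⟩
  · have h1 := abs_le.1 (hw t)
    have h2 := hC t
    have h3 := hD t
    have h4 := hχ t
    -- Up to the factor `χ t`, the value is a convex combination of `C t` and `D t`, hence bounded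
    -- by `1`.
    have h5 : χ t * ((C t + D t) / 2) + χ t * ((D t - C t) / 2) * w t
      = χ t * (C t * ((1 - w t) / 2) + D t * ((1 + w t) / 2)) := by ring
    beta_reduce
    rw [h5, abs_mul, abs_of_nonneg h4.1]
    refine mul_le_one₀ h4.2 (abs_nonneg _) (abs_le.2 ⟨?_, ?_⟩)
    · nlinarith [h2.1, h3.1]
    · nlinarith [h2.2, h3.2]
  · simp [hχ0 ht]
  · intro c d hc hcd hd
    obtain ⟨z, hz⟩ := hφs (⟨c, hc, hcd.trans hd⟩, ⟨d, hc.trans hcd, hd⟩)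
    have hCz : C (e z) = c := by rw [hCe', hz]
    have hDz : D (e z) = d := by rw [hDe', hz]
    have hχz : χ (e z) = 1 := hχ1 ⟨z, rfl⟩
    have hx : e z ∈ Set.Ioo p q := ⟨by linarith [(heI z).1], by linarith [(heI z).2]⟩
    have hAt : ∀ ε > 0, ∀ᶠ t in 𝓝 (e z), |χ t * ((C t + D t) / 2) - (c + d) / 2| < ε := by
      intro ε hε
      have := hA.tendsto (e z)
      rw [hCz, hDz, hχz, one_mul] at this
      exact Metric.tendsto_nhds.1 this ε hε
    have hBt : ∀ ε > 0, ∀ᶠ t in 𝓝 (e z), |χ t * ((D t - C t) / 2) - (d - c) / 2| < ε := by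
      intro ε hε
      have := hB.tendsto (e z)
      rw [hCz, hDz, hχz, one_mul] at this
      exact Metric.tendsto_nhds.1 this ε hε
    have hdiff : ∀ (A B r ε : ℝ), |r| ≤ 1 → |A - (c + d) / 2| < ε → |B - (d - c) / 2| < ε →
        |A + B * r - ((c + d) / 2 + (d - c) / 2 * r)| < 2 * ε := by
      intro A B r ε hr h1 h2
      have h3 : A + B * r - ((c + d) / 2 + (d - c) / 2 * r)
        = (A - (c + d) / 2) + (B - (d - c) / 2) * r := by ring
      rw [h3]
      refine (abs_add_le _ _).trans_lt ?_
      rw [abs_mul]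
      nlinarith [abs_nonneg (B - (d - c) / 2), abs_nonneg r]
    refine ⟨e z, hx, fun ε hε => ?_, fun y hy ε hε => ?_⟩
    · filter_upwards [hAt (ε / 2) (by linarith), hBt (ε / 2) (by linarith)] with t h1 h2
      have h3 := abs_lt.1 (hdiff _ _ (w t) _ (hw t) h1 h2)
      have h4 := abs_le.1 (hw t)
      constructor <;> nlinarith
    · obtain ⟨σ, hσ, hyσ⟩ : ∃ σ : ℝ, (σ = 1 ∨ σ = -1) ∧ y = (c + d) / 2 + (d - c) / 2 * σ := by
        rcases hy with rfl | rfl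
        · exact ⟨-1, Or.inr rfl, by ring⟩
        · exact ⟨1, Or.inl rfl, by ring⟩
      obtain ⟨δ, hδ, hball⟩ := Metric.eventually_nhds_iff.1
        ((hAt (ε / 4) (by linarith)).and (hBt (ε / 4) (by linarith)))
      obtain ⟨t, ht, hwt⟩ := hwS (e z) (Or.inr ⟨z, rfl⟩) σ hσ (min (ε / 2) δ)
        (lt_min (by linarith) hδ)
      obtain ⟨h1, h2⟩ := hball (y := t) (lt_of_lt_of_le ht (min_le_right _ _))
      refine ⟨t, by linarith [min_le_left (ε / 2) δ], ?_⟩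
      have h3 := hdiff _ _ (w t) _ (hw t) h1 h2
      have h4 : |(d - c) / 2 * (w t - σ)| < ε / 2 := by
        rw [abs_mul, abs_of_nonneg (by linarith)]
        nlinarith [min_le_left (ε / 2) δ, abs_nonneg (w t - σ)]
      rw [hyσ]
      rw [abs_lt] at h3 h4 ⊢
      constructor <;> linarith

/-- A compactly supported function with a bounded derivative whose cluster sets are all the compact
subintervals of `[-1, 1]`. -/
theorem exists_exhaustive_bump {α β : ℝ} (hαβ : α < β) : ∃ H h : ℝ → ℝ, ∃ p q : ℝ,
    α < p ∧ q < β ∧ (∀ t, t ∉ Set.Icc p q → H t = 0) ∧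
    (∀ t, HasDerivAt H (h t) t) ∧ (∀ t, |h t| ≤ 1) ∧
    ∀ c d, -1 ≤ c → c ≤ d → d ≤ 1 → ∃ x ∈ Set.Ioo α β,
      (∀ ε > 0, ∀ᶠ t in 𝓝 x, h t ∈ Set.Icc (c - ε) (d + ε)) ∧
      ∀ y, y = c ∨ y = d → ∀ ε > 0, ∃ t, |t - x| < ε ∧ |h t - y| < ε := by
  obtain ⟨l, hl, rfl⟩ : ∃ l > 0, β = α + 4 * l := ⟨(β - α) / 4, by linarith, by ring⟩
  obtain ⟨F, f, hF, hf, hf0, hfc⟩ := exists_exhaustive_derivative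
    (show α + l < α + 2 * l by linarith)
  have hconst : ∀ s t, (∀ r ∈ Set.uIcc s t, f r = 0) → F s = F t := by
    intro s t hst
    have := (convex_uIcc s t).norm_image_sub_le_of_norm_hasDerivWithin_le
      (fun r _ => (hF r).hasDerivWithinAt) (C := 0) (fun r hr => by rw [hst r hr, norm_zero])
      Set.left_mem_uIcc Set.right_mem_uIcc
    rw [zero_mul] at this
    exact (sub_eq_zero.1 (norm_le_zero_iff.1 this)).symm
  -- `F` is constant on either side of `(α + l, α + 2 * l)`, so subtracting the translate by `l`
  -- gives compact support. The two derivatives live on disjoint intervals, which preserves the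
  -- bound `1`.
  have hH : ∀ t, HasDerivAt (fun t => F t - F (t - l)) (f t - f (t - l)) t := fun t =>
    (hF t).fun_sub ((hF (t - l)).comp_sub_const t l)
  refine ⟨fun t => F t - F (t - l), fun t => f t - f (t - l), α + l, α + 3 * l, by linarith,
    by linarith, fun t ht => ?_, hH, fun t => ?_, fun c d hc hcd hd => ?_⟩
  · refine sub_eq_zero.2 (hconst _ _ fun r hr => hf0 r fun hr' => ht ?_)
    rw [Set.uIcc_of_ge (by linarith)] at hr
    exact ⟨by linarith [hr.2, hr'.1], by linarith [hr.1, hr'.2]⟩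
  · beta_reduce
    by_cases ht : t < α + 2 * l
    · rw [hf0 (t - l) (fun h => by linarith [h.1]), sub_zero]
      exact hf t
    · rw [hf0 t (fun h => ht h.2), zero_sub, abs_neg]
      exact hf _
  · obtain ⟨x, hx, h1, h2⟩ := hfc c d hc hcd hd
    have heq : ∀ t < α + 2 * l, f t - f (t - l) = f t := fun t ht => by
      rw [hf0 (t - l) (fun h => by linarith [h.1]), sub_zero]
    refine ⟨x, ⟨by linarith [hx.1], by linarith [hx.2]⟩, fun ε hε => ?_, fun y hy ε hε => ?_⟩
    · filter_upwards [h1 ε hε, Iio_mem_nhds hx.2] with t ht ht'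
      rwa [heq t ht']
    · obtain ⟨t, ht, hty⟩ := h2 y hy (min ε (α + 2 * l - x)) (lt_min hε (by linarith [hx.2]))
      have h3 := lt_of_lt_of_le ht (min_le_right _ _)
      refine ⟨t, lt_of_lt_of_le ht (min_le_left _ _), ?_⟩
      beta_reduce
      rw [heq t (by linarith [le_abs_self (t - x)])]
      exact lt_of_lt_of_le hty (min_le_left _ _)

/-! ### Derivatives, the Lipschitz seminorm and Clarke subdifferentials on `U` -/

theorem extend_subtype_val_apply {U : Set ℝ} (f : U → ℝ) (x : U) :
    Function.extend Subtype.val f 0 (x : ℝ) = f x :=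
  Subtype.val_injective.extend_apply f 0 x

theorem hasDerivOnAt_iff_hasDerivAt {U : Set ℝ} (hU : IsOpen U) {f : U → ℝ} {g : ℝ → ℝ}
    (hfg : ∀ x : U, f x = g x) {d : ℝ} {x : U} : HasDerivOnAt f d x ↔ HasDerivAt g d x := by
  have h : ∀ y ∈ U, Function.extend Subtype.val f 0 y = g y := fun y hy =>
    (extend_subtype_val_apply f ⟨y, hy⟩).trans (hfg ⟨y, hy⟩)
  exact ⟨fun hf => (HasDerivWithinAt.congr_of_mem hf (fun y hy => (h y hy).symm) x.2).hasDerivAt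
    (hU.mem_nhds x.2), fun hg => hg.hasDerivWithinAt.congr_of_mem h x.2⟩

theorem HasDerivOnAt.hasDerivAt {U : Set ℝ} (hU : IsOpen U) {f : U → ℝ} {d : ℝ} {x : U}
    (h : HasDerivOnAt f d x) : HasDerivAt (Function.extend Subtype.val f 0) d x :=
  (hasDerivOnAt_iff_hasDerivAt hU fun y => (extend_subtype_val_apply f y).symm).1 h

theorem HasDerivOnAt.unique {U : Set ℝ} (hU : IsOpen U) {f : U → ℝ} {d e : ℝ} {x : U}
    (h : HasDerivOnAt f d x) (h' : HasDerivOnAt f e x) : d = e :=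
  (h.hasDerivAt hU).unique (h'.hasDerivAt hU)

theorem hasDerivOnAt_congr {U : Set ℝ} {f g : U → ℝ} {x : U} (h : f =ᶠ[𝓝 x] g) {d : ℝ} :
    HasDerivOnAt f d x ↔ HasDerivOnAt g d x := by
  refine Filter.EventuallyEq.hasDerivWithinAt_iff ?_ ?_
  · rw [nhdsWithin_eq_map_subtype_coe x.2, Filter.EventuallyEq, Filter.eventually_map]
    filter_upwards [h] with y hy
    rw [extend_subtype_val_apply, extend_subtype_val_apply, hy]
  · rw [extend_subtype_val_apply, extend_subtype_val_apply, h.self_of_nhds]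

theorem HasDerivOnAt.const_mul {U : Set ℝ} {f : U → ℝ} {d : ℝ} {x : U} (c : ℝ)
    (h : HasDerivOnAt f d x) : HasDerivOnAt (fun t => c * f t) (c * d) x := by
  refine (HasDerivWithinAt.const_mul c h).congr_of_mem (fun y hy => ?_) x.2
  rw [extend_subtype_val_apply _ ⟨y, hy⟩, extend_subtype_val_apply _ ⟨y, hy⟩]

theorem HasDerivOnAt.add_const {U : Set ℝ} {f : U → ℝ} {d : ℝ} {x : U} (c : ℝ)
    (h : HasDerivOnAt f d x) : HasDerivOnAt (fun t => f t + c) d x := by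
  refine (HasDerivWithinAt.add_const c h).congr_of_mem (fun y hy => ?_) x.2
  rw [extend_subtype_val_apply _ ⟨y, hy⟩, extend_subtype_val_apply _ ⟨y, hy⟩]

theorem hasDerivOnAt_zero {U : Set ℝ} (x : U) : HasDerivOnAt (fun _ : U => (0 : ℝ)) 0 x := by
  refine (hasDerivWithinAt_const (x : ℝ) U (0 : ℝ)).congr_of_mem (fun y hy => ?_) x.2
  rw [extend_subtype_val_apply _ ⟨y, hy⟩]

theorem abs_sub_le_of_hasDerivOnAt {U : Set ℝ} (hU : Convex ℝ U) {f : U → ℝ} {C : ℝ}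
    (h : ∀ x, ∃ d, HasDerivOnAt f d x ∧ |d| ≤ C) (x y : U) :
    |f x - f y| ≤ C * |(x : ℝ) - y| := by
  choose d hd hC using h
  have := hU.norm_image_sub_le_of_norm_hasDerivWithin_le
    (f := Function.extend Subtype.val f 0) (f' := Function.extend Subtype.val d 0) (C := C)
    (fun z hz => by rw [extend_subtype_val_apply d ⟨z, hz⟩]; exact hd ⟨z, hz⟩)
    (fun z hz => by rw [extend_subtype_val_apply d ⟨z, hz⟩]; exact hC ⟨z, hz⟩) y.2 x.2
  rwa [extend_subtype_val_apply, extend_subtype_val_apply] at this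

theorem LipSpace.norm_le_of_hasDerivOnAt {U : Set ℝ} (hU : Convex ℝ U) {f : LipSpace U} {C : ℝ}
    (hC : 0 ≤ C) (h : ∀ x, ∃ d, HasDerivOnAt f d x ∧ |d| ≤ C) : ‖f‖ ≤ C :=
  Real.iSup_le (fun p => div_le_of_le_mul₀ (abs_nonneg _) hC
    (abs_sub_le_of_hasDerivOnAt hU h p.1 p.2)) hC

theorem LipSpace.abs_sub_le {U : Set ℝ} (f : LipSpace U) (x y : U) :
    |f x - f y| ≤ ‖f‖ * |(x : ℝ) - y| := by
  rcases eq_or_ne x y with rfl | h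
  · simp
  · have h' : 0 < |(x : ℝ) - y| := abs_pos.2 (sub_ne_zero.2 (Subtype.coe_ne_coe.2 h))
    rw [← div_le_iff₀ h']
    exact le_ciSup f.bddAbove_quotients (x, y)

theorem LipSpace.abs_deriv_le_norm {U : Set ℝ} (hU : IsOpen U) {f : LipSpace U} {d : ℝ} {x : U}
    (h : HasDerivOnAt f d x) : |d| ≤ ‖f‖ := by
  refine (h.hasDerivAt hU).le_of_lip' (norm_nonneg f) ?_
  filter_upwards [hU.mem_nhds x.2] with y hy
  rw [extend_subtype_val_apply _ ⟨y, hy⟩, extend_subtype_val_apply]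
  exact f.abs_sub_le ⟨y, hy⟩ x

/-- A Lipschitz function as an element of `Lip(U)`. -/
def LipSpace.mk {U : Set ℝ} (f : U → ℝ) (hf : ∃ k : ℝ≥0, LipschitzWith k f) : LipSpace U :=
  (⟨f, hf⟩ : lipSubmodule U)

theorem LipSpace.ext {U : Set ℝ} {f g : LipSpace U} (h : ∀ x, f x = g x) : f = g :=
  Subtype.ext (funext h)

theorem exists_lipschitzWith_of_abs_sub_le {U : Set ℝ} {f : U → ℝ} {C : ℝ} (hC : 0 ≤ C)
    (h : ∀ x y : U, |f x - f y| ≤ C * |(x : ℝ) - y|) : ∃ k : ℝ≥0, LipschitzWith k f :=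
  ⟨⟨C, hC⟩, LipschitzWith.of_dist_le_mul h⟩

/-- Passing to the closure of the graph of the derivative replaces sequences by neighbourhood
filters, so that local arguments apply. -/
theorem clarkeSubdiff_eq_convexHull_closure {U : Set ℝ} (f : U → ℝ) (x : U) :
    clarkeSubdiff f x =
      convexHull ℝ {p : ℝ | (x, p) ∈ closure {q : U × ℝ | HasDerivOnAt f q.2 q.1}} := by
  rw [clarkeSubdiff]
  congr 1
  ext p
  rw [Set.mem_ofPred_eq, Set.mem_ofPred_eq, mem_closure_iff_seq_limit]
  constructor
  · rintro ⟨u, d, h, hu, hd⟩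
    exact ⟨fun n => (u n, d n), h, hu.prodMk_nhds hd⟩
  · rintro ⟨s, hs, hl⟩
    exact ⟨fun n => (s n).1, fun n => (s n).2, hs, (Prod.tendsto_iff _ _).1 hl⟩

theorem clarkeSubdiff_congr {U : Set ℝ} {f g : U → ℝ} {x : U} (h : f =ᶠ[𝓝 x] g) :
    clarkeSubdiff f x = clarkeSubdiff g x := by
  rw [clarkeSubdiff_eq_convexHull_closure, clarkeSubdiff_eq_convexHull_closure]
  congr 1
  ext p
  rw [Set.mem_ofPred_eq, Set.mem_ofPred_eq, mem_closure_iff_frequently, mem_closure_iff_frequently]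
  refine Filter.frequently_congr ?_
  filter_upwards [(continuous_fst.tendsto (x, p)).eventually h.eventuallyEq_nhds] with q hq
  exact hasDerivOnAt_congr hq

open scoped Pointwise in
theorem clarkeSubdiff_const_mul {U : Set ℝ} (f : U → ℝ) {c : ℝ} (hc : c ≠ 0) (x : U) :
    clarkeSubdiff (fun t => c * f t) x = c • clarkeSubdiff f x := by
  rw [clarkeSubdiff, clarkeSubdiff, ← convexHull_smul]
  congr 1
  ext p
  rw [Set.mem_smul_set_iff_inv_smul_mem₀ hc]
  constructor
  · rintro ⟨u, d, h, hu, hd⟩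
    refine ⟨u, fun n => c⁻¹ * d n, fun n => ?_, hu, hd.const_mul _⟩
    simpa [← mul_assoc, inv_mul_cancel₀ hc] using (h n).const_mul c⁻¹
  · rintro ⟨u, d, h, hu, hd⟩
    refine ⟨u, fun n => c * d n, fun n => (h n).const_mul c, hu, ?_⟩
    simpa [← mul_assoc, mul_inv_cancel₀ hc] using hd.const_mul c

theorem clarkeSubdiff_add_const {U : Set ℝ} (f : U → ℝ) (c : ℝ) (x : U) :
    clarkeSubdiff (fun t => f t + c) x = clarkeSubdiff f x := by
  rw [clarkeSubdiff_eq_convexHull_closure, clarkeSubdiff_eq_convexHull_closure]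
  have : ∀ (d : ℝ) (t : U), HasDerivOnAt (fun t => f t + c) d t ↔ HasDerivOnAt f d t :=
    fun d t => ⟨fun h => by simpa using h.add_const (-c), fun h => h.add_const c⟩
  simp only [this]

theorem clarkeSubdiff_eq_singleton_zero {U : Set ℝ} (hU : IsOpen U) {f : U → ℝ} {x : U}
    (h : ∀ᶠ t in 𝓝 x, f t = 0) : clarkeSubdiff f x = {0} := by
  rw [clarkeSubdiff_congr (g := fun _ => 0) h, clarkeSubdiff]
  convert convexHull_singleton (𝕜 := ℝ) (0 : ℝ) using 2
  ext p
  constructor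
  · rintro ⟨u, d, hd, -, hp⟩
    have : d = fun _ => 0 := funext fun n => (hd n).unique hU (hasDerivOnAt_zero (u n))
    exact tendsto_nhds_unique hp (this ▸ tendsto_const_nhds)
  · rintro rfl
    exact ⟨fun _ => x, fun _ => 0, fun _ => hasDerivOnAt_zero x, tendsto_const_nhds,
      tendsto_const_nhds⟩

/-- `hev` confines all cluster values to `[c, d]`, and `hcl` makes both end points cluster values;
convexity fills in the rest. -/
theorem clarkeSubdiff_eq_Icc {U : Set ℝ} (hU : IsOpen U) {f : U → ℝ} {h : ℝ → ℝ}
    (hf : ∀ t : U, HasDerivOnAt f (h t) t) {x : U} {c d : ℝ} (hcd : c ≤ d)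
    (hev : ∀ ε > 0, ∀ᶠ t in 𝓝 (x : ℝ), h t ∈ Set.Icc (c - ε) (d + ε))
    (hcl : ∀ y, y = c ∨ y = d → ∀ ε > 0, ∃ t, |t - (x : ℝ)| < ε ∧ |h t - y| < ε) :
    clarkeSubdiff f x = Set.Icc c d := by
  rw [clarkeSubdiff_eq_convexHull_closure]
  have hmem : ∀ y, y = c ∨ y = d →
      (x, y) ∈ closure {q : U × ℝ | HasDerivOnAt f q.2 q.1} := by
    intro y hy
    rw [Metric.mem_closure_iff]
    intro ε hε
    obtain ⟨δ, hδ, hball⟩ := Metric.isOpen_iff.1 hU x x.2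
    obtain ⟨t, ht, hty⟩ := hcl y hy (min ε δ) (lt_min hε hδ)
    have htU : t ∈ U := hball (lt_of_lt_of_le ht (min_le_right _ _))
    refine ⟨(⟨t, htU⟩, h t), hf ⟨t, htU⟩, ?_⟩
    rw [dist_comm, Prod.dist_eq]
    exact max_lt (lt_of_lt_of_le ht (min_le_left _ _)) (lt_of_lt_of_le hty (min_le_left _ _))
  apply Set.Subset.antisymm
  · refine convexHull_min (fun p hp => ?_) (convex_Icc c d)
    rw [Set.mem_ofPred_eq, mem_closure_iff_frequently] at hp
    have key : ∀ ε > 0, p ∈ Set.Icc (c - ε) (d + ε) := by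
      intro ε hε
      have h1 : ∀ᶠ q : U × ℝ in 𝓝 (x, p), HasDerivOnAt f q.2 q.1 →
          q.2 ∈ Set.Icc (c - ε) (d + ε) := by
        have ht : Filter.Tendsto (fun q : U × ℝ => (q.1 : ℝ)) (𝓝 (x, p)) (𝓝 x) :=
          (continuous_subtype_val.comp continuous_fst).tendsto _
        filter_upwards [ht.eventually (hev ε hε)] with q hq hd
        rwa [hd.unique hU (hf q.1)]
      have h2 : p ∈ closure (Set.Icc (c - ε) (d + ε)) := by
        rw [mem_closure_iff_frequently]
        exact (continuous_snd.tendsto (x, p)).frequently ((hp.and_eventually h1).mono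
          fun q hq => hq.2 hq.1)
      rwa [isClosed_Icc.closure_eq] at h2
    exact ⟨le_of_forall_pos_sub_le fun ε hε => (key ε hε).1,
      le_of_forall_pos_le_add fun ε hε => (key ε hε).2⟩
  · rw [← segment_eq_Icc hcd]
    exact (convex_convexHull ℝ _).segment_subset (subset_convexHull ℝ _ (hmem c (Or.inl rfl)))
      (subset_convexHull ℝ _ (hmem d (Or.inr rfl)))

theorem Convex.exists_eq_Icc_of_subset_closedBall {K : Set ℝ} {r : ℝ} (hK : Convex ℝ K)
    (hne : K.Nonempty) (hc : IsClosed K) (hr : K ⊆ Metric.closedBall 0 r) :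
    ∃ c d, -r ≤ c ∧ c ≤ d ∧ d ≤ r ∧ K = Set.Icc c d := by
  have hcomp : IsCompact K := (isCompact_closedBall 0 r).of_isClosed_subset hc hr
  have hIcc := eq_Icc_of_connected_compact ⟨hne, hK.isPreconnected⟩ hcomp
  have h1 := hr (hcomp.sInf_mem hne)
  have h2 := hr (hcomp.sSup_mem hne)
  rw [Real.closedBall_eq_Icc] at h1 h2
  exact ⟨sInf K, sSup K, by linarith [h1.1], csInf_le_csSup hne hcomp.bddBelow hcomp.bddAbove,
    by linarith [h2.2], hIcc⟩

/-! ### Exhaustive functions with disjoint supports -/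

/-- Inside every compact interval of `U` there lives an everywhere differentiable, Clarke
exhaustive function of Lipschitz constant `1`. -/
theorem exists_mem_exhaustiveSet {U : Set ℝ} (hU : IsOpen U) (hUc : Convex ℝ U) {α β : ℝ}
    (hαβ : α < β) (hαU : α ∈ U) (hβU : β ∈ U) : ∃ f ∈ exhaustiveSet U, ‖f‖ = 1 ∧
      tsupport f.toFun ⊆ {t | (t : ℝ) ∈ Set.Ioo α β} := by
  obtain ⟨H, h, p, q, hp, hq, hsupp, hH, hh, hcl⟩ := exists_exhaustive_bump hαβ
  have hHU : ∀ t : U, HasDerivOnAt (fun t : U => H t) (h t) t := fun t =>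
    (hasDerivOnAt_iff_hasDerivAt hU fun _ => rfl).2 (hH t)
  have hsub : Set.Ioo α β ⊆ U := Set.Ioo_subset_Icc_self.trans (hUc.ordConnected.out hαU hβU)
  let f : LipSpace U := LipSpace.mk (fun t => H t) (exists_lipschitzWith_of_abs_sub_le zero_le_one
    (abs_sub_le_of_hasDerivOnAt hUc fun x => ⟨h x, hHU x, hh x⟩))
  have hf : ∀ t : U, HasDerivOnAt f (h t) t := hHU
  have hnorm : ‖f‖ = 1 := by
    refine le_antisymm (LipSpace.norm_le_of_hasDerivOnAt hUc zero_le_one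
      fun x => ⟨h x, hf x, hh x⟩) (le_of_forall_pos_sub_le fun ε hε => ?_)
    -- The degenerate interval `{1}` provides derivatives arbitrarily close to `1`, whence the lower
    -- bound for the seminorm.
    obtain ⟨x, hx, -, hx1⟩ := hcl 1 1 (by norm_num) le_rfl le_rfl
    obtain ⟨δ, hδ, hball⟩ := Metric.isOpen_iff.1 hU x (hsub hx)
    obtain ⟨t, ht, ht1⟩ := hx1 1 (Or.inl rfl) (min ε δ) (lt_min hε hδ)
    have htU : t ∈ U := hball (lt_of_lt_of_le ht (min_le_right _ _))
    have h1 := LipSpace.abs_deriv_le_norm hU (hf ⟨t, htU⟩)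
    have h2 := abs_lt.1 (lt_of_lt_of_le ht1 (min_le_left _ _))
    linarith [le_abs_self (h t)]
  refine ⟨f, ⟨fun x => ⟨_, hf x⟩, fun K hKn hKc hK hKb => ?_⟩, hnorm, ?_⟩
  · rw [hnorm] at hKb
    obtain ⟨c, d, hc, hcd, hd, rfl⟩ := hK.exists_eq_Icc_of_subset_closedBall hKn hKc hKb
    obtain ⟨x, hx, h1, h2⟩ := hcl c d hc hcd hd
    exact ⟨⟨x, hsub hx⟩, clarkeSubdiff_eq_Icc hU hf hcd h1 h2⟩
  · have : tsupport f.toFun ⊆ {t | (t : ℝ) ∈ Set.Icc p q} := by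
      refine closure_minimal (fun t ht => ?_) (isClosed_Icc.preimage continuous_subtype_val)
      by_contra h'
      exact ht (hsupp t h')
    exact fun t ht => ⟨hp.trans_le (this ht).1, (this ht).2.trans_lt hq⟩

theorem isOpen_openInterval (a b : EReal) : IsOpen (openInterval a b) :=
  (isOpen_Ioi.preimage continuous_coe_real_ereal).inter
    (isOpen_Iio.preimage continuous_coe_real_ereal)

theorem convex_openInterval (a b : EReal) : Convex ℝ (openInterval a b) := by
  refine Set.OrdConnected.convex ⟨fun x hx y hy z hz => ⟨?_, ?_⟩⟩
  · exact hx.1.trans_le (EReal.coe_le_coe_iff.2 hz.1)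
  · exact (EReal.coe_le_coe_iff.2 hz.2).trans_lt hy.2

theorem exists_isDisjointExhaustiveSeq {a b : EReal} (hab : a < b) :
    ∃ (α β : ℕ → ℝ) (f : ℕ → LipSpace (openInterval a b)), IsDisjointExhaustiveSeq a b α β f := by
  obtain ⟨q, haq, hqb⟩ := EReal.lt_iff_exists_real_btwn.1 hab
  obtain ⟨p, hap, hpq⟩ := EReal.lt_iff_exists_real_btwn.1 haq
  rw [EReal.coe_lt_coe_iff] at hpq
  have hp : ∀ n : ℕ, p ≤ q - (q - p) / (n + 1) := fun n => by
    have : (q - p) / (n + 1) ≤ q - p :=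
      div_le_self (by linarith) (by linarith [n.cast_nonneg (α := ℝ)])
    linarith
  have hq : ∀ n : ℕ, q - (q - p) / (n + 1) < q := fun n => by
    have : 0 < (q - p) / (n + 1) := div_pos (by linarith) n.cast_add_one_pos
    linarith
  have hlt : ∀ n : ℕ, q - (q - p) / (n + 1) < q - (q - p) / ((n + 1 : ℕ) + 1) := fun n => by
    have h0 : (0 : ℝ) < n + 1 := n.cast_add_one_pos
    have : (q - p) / ((n + 1 : ℕ) + 1) < (q - p) / (n + 1) := by
      apply div_lt_div_of_pos_left (by linarith) h0
      push_cast
      linarith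
    linarith
  have hmem : ∀ n : ℕ, q - (q - p) / (n + 1) ∈ openInterval a b := fun n =>
    ⟨hap.trans_le (EReal.coe_le_coe_iff.2 (hp n)),
      (EReal.coe_lt_coe_iff.2 (hq n)).trans hqb⟩
  -- The points `q - (q - p) / (n + 1)` increase; using every second interval between neighbours
  -- leaves gaps, so that `β n < α (n + 1)` strictly.
  choose f hf hf1 hfs using fun n : ℕ => exists_mem_exhaustiveSet (isOpen_openInterval a b)
    (convex_openInterval a b) (hlt (2 * n)) (hmem _) (hmem _)
  exact ⟨fun n => q - (q - p) / ((2 * n : ℕ) + 1), fun n => q - (q - p) / ((2 * n + 1 : ℕ) + 1), f,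
    fun n => (hmem _).1, fun n => hlt (2 * n), fun n => hlt (2 * n + 1), fun n => (hmem _).2, hf,
    hf1, hfs⟩

/-! ### The isometric embedding of `c₀` -/

namespace IsDisjointExhaustiveSeq

variable {a b : EReal} {α β : ℕ → ℝ} {f : ℕ → LipSpace (openInterval a b)}

theorem right_lt_left (hs : IsDisjointExhaustiveSeq a b α β f) {m n : ℕ} (h : m < n) :
    β m < α n := by
  induction n, h using Nat.le_induction with
  | base => exact hs.lt_succ m
  | succ n _ ih => exact (ih.trans (hs.lt n)).trans (hs.lt_succ n)

theorem apply_eq_zero (hs : IsDisjointExhaustiveSeq a b α β f) {n : ℕ} {t : openInterval a b}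
    (ht : (t : ℝ) ∉ Set.Ioo (α n) (β n)) : f n t = 0 :=
  image_eq_zero_of_notMem_tsupport fun h => ht (hs.supp n h)

theorem eventually_apply_eq_zero (hs : IsDisjointExhaustiveSeq a b α β f) {n : ℕ}
    {t : openInterval a b} (ht : (t : ℝ) ∉ Set.Ioo (α n) (β n)) : ∀ᶠ s in 𝓝 t, f n s = 0 :=
  notMem_tsupport_iff_eventuallyEq.1 fun h => ht (hs.supp n h)

theorem hasSum_of_mem (hs : IsDisjointExhaustiveSeq a b α β f) (x : C₀(ℕ, ℝ)) {n : ℕ}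
    {t : openInterval a b} (ht : (t : ℝ) ∈ Set.Ioo (α n) (β n)) :
    HasSum (fun m => x m * f m t) (x n * f n t) := by
  refine hasSum_single n fun m hm => ?_
  rw [hs.apply_eq_zero, mul_zero]
  rintro ⟨h1, h2⟩
  rcases lt_or_gt_of_ne hm with h | h
  · linarith [hs.right_lt_left h, ht.1]
  · linarith [hs.right_lt_left h, ht.2]

theorem hasSum_of_forall_notMem (hs : IsDisjointExhaustiveSeq a b α β f) (x : C₀(ℕ, ℝ))
    {t : openInterval a b} (ht : ∀ n, (t : ℝ) ∉ Set.Ioo (α n) (β n)) :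
    HasSum (fun m => x m * f m t) 0 := by
  have : (fun m => x m * f m t) = fun _ => 0 :=
    funext fun m => by rw [hs.apply_eq_zero (ht m), mul_zero]
  rw [this]
  exact hasSum_zero

theorem summable (hs : IsDisjointExhaustiveSeq a b α β f) (x : C₀(ℕ, ℝ))
    (t : openInterval a b) : Summable fun m => x m * f m t := by
  by_cases h : ∃ n, (t : ℝ) ∈ Set.Ioo (α n) (β n)
  · obtain ⟨n, hn⟩ := h
    exact (hs.hasSum_of_mem x hn).summable
  · exact (hs.hasSum_of_forall_notMem x (not_exists.1 h)).summable

theorem tsum_eventuallyEq_of_mem (hs : IsDisjointExhaustiveSeq a b α β f) (x : C₀(ℕ, ℝ)) {n : ℕ}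
    {t : openInterval a b} (ht : (t : ℝ) ∈ Set.Ioo (α n) (β n)) :
    (fun s => ∑' m, x m * f m s) =ᶠ[𝓝 t] fun s => x n * f n s := by
  filter_upwards [continuous_subtype_val.continuousAt (Ioo_mem_nhds ht.1 ht.2)] with s hsn
  exact (hs.hasSum_of_mem x hsn).tsum_eq

/-- To the left of `α N` only the first `N` terms can be nonzero, and each of them vanishes near `t`
because its closed support misses `t`. -/
theorem tsum_eventually_eq_zero (hs : IsDisjointExhaustiveSeq a b α β f) (x : C₀(ℕ, ℝ)) {N : ℕ}
    {t : openInterval a b} (ht : ∀ n, (t : ℝ) ∉ Set.Ioo (α n) (β n)) (htN : (t : ℝ) < α N) :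
    ∀ᶠ s : openInterval a b in 𝓝 t, ∑' m, x m * f m s = 0 := by
  filter_upwards [continuous_subtype_val.continuousAt (Iio_mem_nhds htN),
    (Filter.eventually_all_finset (Finset.range N)).2
      fun n _ => hs.eventually_apply_eq_zero (ht n)] with s hsN hs0
  have : (fun m => x m * f m s) = fun _ => 0 := by
    funext m
    by_cases hm : m < N
    · rw [hs0 m (Finset.mem_range.2 hm), mul_zero]
    · rw [hs.apply_eq_zero, mul_zero]
      intro h
      have h1 : (s : ℝ) < α N := hsN
      rcases eq_or_lt_of_le (not_lt.1 hm) with rfl | h2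
      · linarith [h.1]
      · linarith [h.1, hs.right_lt_left h2, hs.lt N]
  rw [this, tsum_zero]

theorem abs_apply_le_norm (x : C₀(ℕ, ℝ)) (n : ℕ) : |x n| ≤ ‖x‖ :=
  x.toBCF.norm_coe_le_norm n

theorem exists_hasDerivOnAt_tsum (hs : IsDisjointExhaustiveSeq a b α β f) (x : C₀(ℕ, ℝ))
    (t : openInterval a b) :
    ∃ d, HasDerivOnAt (fun s : openInterval a b => ∑' m, x m * f m s) d t ∧ |d| ≤ ‖x‖ := by
  by_cases h : ∃ n, (t : ℝ) ∈ Set.Ioo (α n) (β n)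
  · obtain ⟨n, hn⟩ := h
    obtain ⟨d, hd⟩ := (hs.mem n).1 t
    refine ⟨x n * d, (hasDerivOnAt_congr (hs.tsum_eventuallyEq_of_mem x hn)).2 (hd.const_mul _), ?_⟩
    have h1 := LipSpace.abs_deriv_le_norm (isOpen_openInterval a b) hd
    rw [hs.norm_eq] at h1
    rw [abs_mul]
    exact (mul_le_of_le_one_right (abs_nonneg _) h1).trans (abs_apply_le_norm x n)
  push Not at h
  refine ⟨0, ?_, by simp⟩
  by_cases hN : ∃ N, (t : ℝ) < α N
  · obtain ⟨N, hN⟩ := hN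
    exact (hasDerivOnAt_congr (hs.tsum_eventually_eq_zero x h hN)).2 (hasDerivOnAt_zero t)
  push Not at hN
  -- Now `t` lies to the right of all the intervals, which may accumulate at it. Near `t` only
  -- indices `n ≥ N` matter, and there the sum is at most `|x n| * |s - t|`; this is where `x n → 0`
  -- enters.
  rw [HasDerivOnAt, hasDerivWithinAt_iff_isLittleO, Asymptotics.isLittleO_iff]
  intro ε hε
  have hx : ∀ᶠ n in Filter.atTop, |x n| < ε := by
    have := zero_at_infty x
    rw [Filter.cocompact_eq_cofinite, Nat.cofinite_eq_atTop] at this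
    simpa using (Metric.tendsto_nhds.1 this) ε hε
  obtain ⟨N, hxN⟩ := Filter.eventually_atTop.1 hx
  filter_upwards [self_mem_nhdsWithin, mem_nhdsWithin_of_mem_nhds
    (Ioi_mem_nhds ((hs.lt_succ N).trans_le (hN _)))] with s hsU hsN
  rw [extend_subtype_val_apply, extend_subtype_val_apply _ ⟨s, hsU⟩,
    (hs.hasSum_of_forall_notMem x h).tsum_eq, smul_zero, sub_zero, sub_zero]
  by_cases hn : ∃ n, s ∈ Set.Ioo (α n) (β n)
  · obtain ⟨n, hn⟩ := hn
    have hNn : N ≤ n := by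
      by_contra! hlt
      have h1 : β N < s := hsN
      linarith [hs.right_lt_left hlt, hs.lt N, hn.2]
    rw [(hs.hasSum_of_mem x (t := ⟨s, hsU⟩) hn).tsum_eq, norm_mul, Real.norm_eq_abs,
      Real.norm_eq_abs, Real.norm_eq_abs]
    have h1 := (f n).abs_sub_le ⟨s, hsU⟩ t
    rw [hs.apply_eq_zero (h n), hs.norm_eq, sub_zero, one_mul] at h1
    exact mul_le_mul (hxN n hNn).le h1 (abs_nonneg _) hε.le
  · rw [(hs.hasSum_of_forall_notMem x (t := ⟨s, hsU⟩) (not_exists.1 hn)).tsum_eq, norm_zero]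
    positivity

/-- The function `∑ n, x n * f n` as an element of `Lip(I)`. -/
noncomputable def sumLip (hs : IsDisjointExhaustiveSeq a b α β f) (x : C₀(ℕ, ℝ)) :
    LipSpace (openInterval a b) :=
  LipSpace.mk (fun t => ∑' m, x m * f m t) (exists_lipschitzWith_of_abs_sub_le (norm_nonneg x)
    (abs_sub_le_of_hasDerivOnAt (convex_openInterval a b) (hs.exists_hasDerivOnAt_tsum x)))

theorem hasSum_sumLip (hs : IsDisjointExhaustiveSeq a b α β f) (x : C₀(ℕ, ℝ))
    (t : openInterval a b) : HasSum (fun n => x n * f n t) (hs.sumLip x t) :=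
  (hs.summable x t).hasSum

theorem abs_apply_le_norm_sumLip (hs : IsDisjointExhaustiveSeq a b α β f) (x : C₀(ℕ, ℝ)) (n : ℕ) :
    |x n| ≤ ‖hs.sumLip x‖ := by
  -- At each point `x n • f n` has either a derivative of the whole sum or the derivative `0`, so
  -- its seminorm cannot exceed that of the sum.
  have h1 : ‖x n • f n‖ = |x n| := by rw [norm_smul, hs.norm_eq, mul_one, Real.norm_eq_abs]
  rw [← h1]
  refine LipSpace.norm_le_of_hasDerivOnAt (convex_openInterval a b) (norm_nonneg _) fun t => ?_
  by_cases ht : (t : ℝ) ∈ Set.Ioo (α n) (β n)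
  · obtain ⟨d, hd⟩ := (hs.mem n).1 t
    refine ⟨x n * d, hd.const_mul _, ?_⟩
    exact LipSpace.abs_deriv_le_norm (isOpen_openInterval a b) (f := hs.sumLip x)
      ((hasDerivOnAt_congr (hs.tsum_eventuallyEq_of_mem x ht)).2 (hd.const_mul _))
  · refine ⟨0, (hasDerivOnAt_congr ?_).2 (hasDerivOnAt_zero t), by simp⟩
    filter_upwards [hs.eventually_apply_eq_zero ht] with s h0
    show x n * f n s = 0
    rw [h0, mul_zero]

theorem norm_sumLip (hs : IsDisjointExhaustiveSeq a b α β f) (x : C₀(ℕ, ℝ)) :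
    ‖hs.sumLip x‖ = ‖x‖ := by
  refine le_antisymm (LipSpace.norm_le_of_hasDerivOnAt (convex_openInterval a b) (norm_nonneg x)
    (hs.exists_hasDerivOnAt_tsum x)) ?_
  rw [← ZeroAtInftyContinuousMap.norm_toBCF_eq_norm]
  exact (BoundedContinuousFunction.norm_le (norm_nonneg _)).2 (hs.abs_apply_le_norm_sumLip x)

/-- The linear isometry `x ↦ ∑ n, x n * f n` from `c₀` to `Lip(I)`. -/
noncomputable def sumLipₗᵢ (hs : IsDisjointExhaustiveSeq a b α β f) :
    C₀(ℕ, ℝ) →ₗᵢ[ℝ] LipSpace (openInterval a b) where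
  toFun := hs.sumLip
  map_add' x y := LipSpace.ext fun t => (hs.hasSum_sumLip (x + y) t).unique <| by
    simpa [LipSpace.add_apply, add_mul] using (hs.hasSum_sumLip x t).add (hs.hasSum_sumLip y t)
  map_smul' c x := LipSpace.ext fun t => (hs.hasSum_sumLip (c • x) t).unique <| by
    simpa [LipSpace.smul_apply, mul_assoc] using (hs.hasSum_sumLip x t).mul_left c
  norm_map' := hs.norm_sumLip

end IsDisjointExhaustiveSeq

/-- An attained norm lets a single term `x N * f N` realise every `K` in the ball, including those
reaching its boundary. -/
theorem ZeroAtInftyContinuousMap.exists_norm_eq_abs_apply (x : C₀(ℕ, ℝ)) :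
    ∃ n, ‖x‖ = |x n| := by
  by_cases hx : ∀ n, x n = 0
  · have : x = 0 := by ext n; exact hx n
    exact ⟨0, by simp [this]⟩
  push Not at hx
  obtain ⟨k, hk⟩ := hx
  have hc : Continuous fun n => |x n| := by fun_prop
  obtain ⟨n, hn⟩ := hc.exists_forall_ge' k (by
    filter_upwards [Metric.tendsto_nhds.1 (zero_at_infty x) |x k| (abs_pos.2 hk)] with m hm
    rw [dist_zero_right] at hm
    exact hm.le)
  refine ⟨n, le_antisymm ?_ (x.toBCF.norm_coe_le_norm n)⟩
  rw [← ZeroAtInftyContinuousMap.norm_toBCF_eq_norm]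
  exact (BoundedContinuousFunction.norm_le (abs_nonneg _)).2 hn

open scoped Pointwise in
theorem IsDisjointExhaustiveSeq.sumLip_mem_exhaustiveSet {a b : EReal} {α β : ℕ → ℝ}
    {f : ℕ → LipSpace (openInterval a b)} (hs : IsDisjointExhaustiveSeq a b α β f)
    (x : C₀(ℕ, ℝ)) : hs.sumLip x ∈ exhaustiveSet (openInterval a b) := by
  refine ⟨fun t => (hs.exists_hasDerivOnAt_tsum x t).imp fun d h => h.1,
    fun K hKn hKc hK hKb => ?_⟩
  -- The set `{0}` needs a point of its own: the point at which `f N` realises it may lie outside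
  -- `(α N, β N)`, where other terms contribute. Near `β 0` the whole sum vanishes.
  have hzero : ∃ t, clarkeSubdiff (hs.sumLip x).toFun t = {0} := by
    let t : openInterval a b := ⟨β 0, (hs.left_lt 0).trans (EReal.coe_lt_coe_iff.2 (hs.lt 0)),
      hs.lt_right 0⟩
    refine ⟨t, clarkeSubdiff_eq_singleton_zero (isOpen_openInterval a b)
      (hs.tsum_eventually_eq_zero x (t := t) (N := 1) (fun n hn => ?_) (hs.lt_succ 0))⟩
    rcases Nat.eq_zero_or_pos n with rfl | h
    · exact lt_irrefl _ hn.2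
    · exact lt_asymm hn.1 (hs.right_lt_left h)
  obtain ⟨N, hN⟩ := x.exists_norm_eq_abs_apply
  rw [hs.norm_sumLip, hN] at hKb
  by_cases hx0 : x N = 0
  · rw [hx0, abs_zero, Metric.closedBall_zero] at hKb
    rw [hKn.subset_singleton_iff.1 hKb]
    exact hzero
  · obtain ⟨t, ht⟩ := (hs.mem N).2 ((x N)⁻¹ • K) (hKn.smul_set)
      (hKc.smul_of_ne_zero (inv_ne_zero hx0)) (hK.smul _) (by
        rw [hs.norm_eq]
        refine (Set.smul_set_mono hKb).trans ?_
        rw [smul_closedBall' (inv_ne_zero hx0), smul_zero, norm_inv, Real.norm_eq_abs,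
          inv_mul_cancel₀ (abs_ne_zero.2 hx0)])
    by_cases htN : (t : ℝ) ∈ Set.Ioo (α N) (β N)
    · refine ⟨t, ?_⟩
      rw [clarkeSubdiff_congr (f := (hs.sumLip x).toFun) (hs.tsum_eventuallyEq_of_mem x htN),
        clarkeSubdiff_const_mul _ hx0, ht, smul_inv_smul₀ hx0]
    · rw [clarkeSubdiff_eq_singleton_zero (isOpen_openInterval a b)
        (hs.eventually_apply_eq_zero htN)] at ht
      have : K = {0} := by
        rw [← smul_inv_smul₀ hx0 K, ← ht, Set.smul_set_singleton, smul_zero]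
      rw [this]
      exact hzero

/-! ### Spaceability -/

theorem not_finiteDimensional_zeroAtInfty_nat : ¬ FiniteDimensional ℝ C₀(ℕ, ℝ) := by
  intro h
  -- One coordinate more than the supposed dimension: evaluation at the first `n` indices is onto, a
  -- contradiction.
  let n := Module.finrank ℝ C₀(ℕ, ℝ) + 1
  let ev : C₀(ℕ, ℝ) →ₗ[ℝ] (Fin n → ℝ) :=
    { toFun := fun x i => x i
      map_add' := fun _ _ => rfl
      map_smul' := fun _ _ => rfl }
  have hev : Function.Surjective ev := by
    intro y
    refine ⟨⟨⟨fun m => if h : m < n then y ⟨m, h⟩ else 0, continuous_of_discreteTopology⟩, ?_⟩, ?_⟩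
    · rw [Filter.cocompact_eq_cofinite, Nat.cofinite_eq_atTop]
      refine tendsto_const_nhds.congr' ?_
      filter_upwards [Filter.eventually_ge_atTop n] with m hm
      simp [not_lt.2 hm]
    · ext i
      simp [ev]
  have := LinearMap.finrank_le_finrank_of_surjective hev
  rw [Module.finrank_fin_fun] at this
  omega

/-- Seminorm zero means constant, and constants affect neither derivatives nor the seminorm. -/
theorem mem_exhaustiveSet_of_norm_sub_eq_zero {U : Set ℝ} {f g : LipSpace U}
    (hf : f ∈ exhaustiveSet U) (h : ‖g - f‖ = 0) : g ∈ exhaustiveSet U := by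
  rcases isEmpty_or_nonempty U with hU | ⟨⟨x₀⟩⟩
  · rwa [LipSpace.ext (f := g) (g := f) fun x => hU.elim x]
  have hg : g.toFun = fun t => f t + (g x₀ - f x₀) := by
    funext t
    have h1 := (g - f).abs_sub_le t x₀
    rw [h, zero_mul] at h1
    have h2 : (g t - f t) - (g x₀ - f x₀) = 0 := abs_nonpos_iff.1 h1
    linarith
  have hn : ‖g‖ = ‖f‖ := by
    refine le_antisymm ?_ ?_
    · have := norm_add_le (g - f) f
      rwa [sub_add_cancel, h, zero_add] at this
    · have := norm_sub_le g (g - f)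
      rwa [sub_sub_cancel, h, add_zero] at this
  refine ⟨fun x => ?_, fun K hKn hKc hK hKb => ?_⟩
  · obtain ⟨d, hd⟩ := hf.1 x
    exact ⟨d, hg ▸ hd.add_const _⟩
  · obtain ⟨x, hx⟩ := hf.2 K hKn hKc hK (hn ▸ hKb)
    refine ⟨x, ?_⟩
    rw [hg, clarkeSubdiff_add_const, hx]

/-- Completeness of `E` gives a limit of the preimages; since `F` is only seminormed, its image
agrees with `y` up to seminorm zero. -/
theorem LinearIsometry.exists_norm_sub_eq_zero_of_mem_closure_range {E F : Type*}
    [NormedAddCommGroup E] [NormedSpace ℝ E] [CompleteSpace E] [SeminormedAddCommGroup F]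
    [NormedSpace ℝ F] (T : E →ₗᵢ[ℝ] F) {y : F} (hy : y ∈ closure (Set.range T)) :
    ∃ x, ‖y - T x‖ = 0 := by
  obtain ⟨s, hs, hsy⟩ := mem_closure_iff_seq_limit.1 hy
  choose u hu using hs
  have hcs : CauchySeq u := by
    have h := hsy.cauchySeq
    rw [← funext hu] at h
    rwa [CauchySeq, ← T.isometry.isUniformInducing.cauchy_map_iff, Filter.map_map]
  obtain ⟨x, hx⟩ := cauchySeq_tendsto_of_complete hcs
  have h1 : Filter.Tendsto s Filter.atTop (𝓝 (T x)) := by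
    convert (T.continuous.tendsto x).comp hx using 1
    exact (funext hu).symm
  refine ⟨x, tendsto_nhds_unique (hsy.sub h1).norm ?_⟩
  simp

theorem mainTheorem8 (a b : EReal) (hab : a < b) :
    IsSpaceable (exhaustiveSet (openInterval a b)) ∧
    (∃ (α β : ℕ → ℝ) (f : ℕ → LipSpace (openInterval a b)),
      IsDisjointExhaustiveSeq a b α β f) ∧
    (∀ (α β : ℕ → ℝ) (f : ℕ → LipSpace (openInterval a b)),
      IsDisjointExhaustiveSeq a b α β f →
        ∃ T : C₀(ℕ, ℝ) →ₗᵢ[ℝ] LipSpace (openInterval a b),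
          (∀ (x : C₀(ℕ, ℝ)) (t : openInterval a b),
            HasSum (fun n => x n * f n t) (T x t)) ∧
          ∀ x : C₀(ℕ, ℝ), T x ∈ exhaustiveSet (openInterval a b)) := by
  refine ⟨?_, exists_isDisjointExhaustiveSeq hab, fun α β f hs =>
    ⟨hs.sumLipₗᵢ, hs.hasSum_sumLip, hs.sumLip_mem_exhaustiveSet⟩⟩
  obtain ⟨α, β, f, hs⟩ := exists_isDisjointExhaustiveSeq hab
  let T := hs.sumLipₗᵢ
  have hT : ∀ x, T x ∈ exhaustiveSet (openInterval a b) := hs.sumLip_mem_exhaustiveSet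
  -- The range itself is not closed: a closed subspace contains all constants, whereas each `T x`
  -- vanishes at `β 0`.
  refine ⟨(LinearMap.range T.toLinearMap).topologicalClosure,
    Submodule.isClosed_topologicalClosure _, fun hfin => ?_, fun y hy => ?_⟩
  · have hinj : Function.Injective (T.toLinearMap.codRestrict
        (LinearMap.range T.toLinearMap).topologicalClosure
        fun x => Submodule.le_topologicalClosure _ ⟨x, rfl⟩) := fun x y hxy =>
      T.injective (congrArg Subtype.val hxy)
    exact not_finiteDimensional_zeroAtInfty_nat (FiniteDimensional.of_injective _ hinj)
  · obtain ⟨x, hx⟩ := T.exists_norm_sub_eq_zero_of_mem_closure_range (y := y) hy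
    exact mem_exhaustiveSet_of_norm_sub_eq_zero (hT x) hx
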